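/- Let $a\neq 0$ be a real number and let $F=\{f_1<\dots<f_k\}$ be a finite (possibly empty) set of positive integers. Let $$c_n^a(x)=\frac1{n!}\sum_{j=0}^n(-a)^{n-j}\binom nj\binom xj j!\quad(n\ge 0),\qquad c_n^a=0\quad(n<0),$$ be the Charlier polynomials, and put $$u_F=\sum_{f\in F}f-\binom{k+1}2,\qquad w_F=\sum_{f\in F}f-\binom k2+1 .$$ For $n\in\mathbb Z$ let the exceptional Charlier polynomial $c_n^{a;F}(x)$ be the determinant of the $(k+1)\times(k+1)$ matrix whose first row is $\big(c^a_{n-u_F}(x),c^a_{n-u_F}(x+1),\dots,c^a_{n-u_F}(x+k)\big)$ and whose $(i+1)$-st row is $\big(c^a_{f_i}(x),c^a_{f_i}(x+1),\dots,c^a_{f_i}(x+k)\big)$, $i=1,\dots,k$. Let $$\Omega_F^a(x)=\det\big(c^a_{f_i}(x+j-1)\big)_{i,j=1}^k$$ (equal to $1$ if $k=0$). Then there is a polynomial $\lambda_F^a$ with $$\lambda_F^a(x)-\lambda_F^a(x-1)=\Omega_F^a(x),$$ and every such polynomial $\lambda_F^a$ (they differ by additive constants) has degree $w_F$ and has the following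 property. There are rational functions $A_j$, $-w_F\le j\le w_F$, with real coefficients, not depending on $x$ and whose denominators (in lowest terms) do not vanish at any $n\in\mathbb N=\{0,1,2,\dots\}$, such that $$\sum_{j=-w_F}^{w_F}A_j(n)\,c_{n+j}^{a;F}(x)=\lambda_F^a(x)\,c_n^{a;F}(x)\qquad\text{for all } n\ge 0,$$ and this recurrence has order $2w_F+1$, that is, $A_{w_F}(n)\neq 0$ for all sufficiently large $n$. -/

import Mathlib

open Polynomial

/-- The binomial coefficient `binom(x, j) = x (x - 1) ⋯ (x - j + 1) / j!`, a polynomial in `x`. -/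
noncomputable def binomPoly (j : ℕ) : ℝ[X] :=
  C ((j.factorial : ℝ)⁻¹) * descPochhammer ℝ j

/-- The Charlier polynomial `c_n^a(x)`, with `c_n^a = 0` for `n < 0`. -/
noncomputable def charlier (a : ℝ) (n : ℤ) : ℝ[X] :=
  if n < 0 then 0
  else C ((n.toNat.factorial : ℝ)⁻¹) *
    ∑ j ∈ Finset.range (n.toNat + 1),
      C ((-a) ^ (n.toNat - j) * (n.toNat.choose j : ℝ)) * binomPoly j * C (j.factorial : ℝ)

/-- The polynomial `p(x + s)`. -/
noncomputable def shiftPoly (p : ℝ[X]) (s : ℝ) : ℝ[X] :=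
  p.comp (X + C s)

/-- `u_F = ∑_{f ∈ F} f - binom(k + 1, 2)`, where `k` is the number of elements of `F`. -/
def uF (F : Finset ℕ) : ℤ :=
  (∑ f ∈ F, (f : ℤ)) - ((F.card + 1).choose 2 : ℤ)

/-- `w_F = ∑_{f ∈ F} f - binom(k, 2) + 1`, where `k` is the number of elements of `F`. -/
def wF (F : Finset ℕ) : ℤ :=
  (∑ f ∈ F, (f : ℤ)) - (F.card.choose 2 : ℤ) + 1

/-- The `(i + 1)`-st smallest element of `F`. -/
def nthElem (F : Finset ℕ) (i : Fin F.card) : ℕ :=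
  F.orderEmbOfFin rfl i

/-- The matrix of size `k + 1` whose first row is `c_{n - u_F}^a(x + j)`, `j = 0, …, k`, and whose
other rows are `c_f^a(x + j)`, `j = 0, …, k`, for `f ∈ F` in increasing order. -/
noncomputable def exceptionalCharlierMatrix (a : ℝ) (F : Finset ℕ) (n : ℤ) :
    Matrix (Fin (F.card + 1)) (Fin (F.card + 1)) ℝ[X] :=
  Matrix.of (Fin.cons
    (fun j : Fin (F.card + 1) => shiftPoly (charlier a (n - uF F)) (j : ℕ))
    (fun (i : Fin F.card) (j : Fin (F.card + 1)) =>
      shiftPoly (charlier a (nthElem F i)) (j : ℕ)))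

/-- The exceptional Charlier polynomial `c_n^{a;F}`. -/
noncomputable def exceptionalCharlier (a : ℝ) (F : Finset ℕ) (n : ℤ) : ℝ[X] :=
  (exceptionalCharlierMatrix a F n).det

/-- The Casoratian `Ω_F^a(x) = det (c_{f_i}^a(x + j - 1))`, `i, j = 1, …, k`. -/
noncomputable def casoratian (a : ℝ) (F : Finset ℕ) : ℝ[X] :=
  (Matrix.of fun i j : Fin F.card =>
    shiftPoly (charlier a (nthElem F i)) (j : ℕ)).det

/-- `L` is one of the polynomials `λ_F^a`, which are determined up to an additive constant by
`λ(x) - λ(x - 1) = Ω_F^a(x)`. -/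
def IsLambda (a : ℝ) (F : Finset ℕ) (L : ℝ[X]) : Prop :=
  L - shiftPoly L (-1) = casoratian a F

/-- The value at `n` of a rational function with real coefficients. -/
noncomputable def ratVal (A : RatFunc ℝ) (n : ℕ) : ℝ :=
  A.eval (RingHom.id ℝ) (n : ℝ)

/-!
# Recurrences for exceptional Charlier polynomials

Let `q i` be the Charlier polynomials with degrees in `F`, let `Ω` be their Casoratian, and let
`T p` be the Casoratian determinant of `p` and the `q i`, so that `c_n^{a;F} = T (c_{n - u_F})`.

The heart of the matter is that the multiplication by `L`, with `L (x) - L (x - 1) = Ω (x)`, lifts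
through `T` (`casoratiOp_sub_sum`): given `p`, let `h i` have as its difference the determinant
`Ω` with `p` in place of `q i`, and put `r (x) = L (x) p (x) - ∑ q i (x) h i (x + 1)`. Cramer's rule
gives `r (x + j) = L (x) p (x + j) - ∑ q i (x + j) h i (x + 1)` for all `0 ≤ j ≤ k`, hence
`T r = L * T p` by row operations.

For `p = c_m` the polynomial `r` is a combination `∑ B_s (m) c_{m + s}` with coefficients that are
*polynomials* in `m`: shifts and multiplication by `x` act on the `c_m` by such combinations, and
differences are inverted by `c_m ↦ c_{m + 1}` (`exists_casoratiOp_recSum_eq`). As `T` is linear,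
`A_j (n) = B_j (n - u_F)` are coefficients as required, once it is shown that the extreme
indices `s` with `B_s ≠ 0` are `w_F` and `-w_F`.

For the upper index compare degrees: the degree of `T c_m` is `m + u_F` for `m ∉ F` by a
Vandermonde determinant, so that the top term of `∑ B_s (m) T c_{m + s}` has to raise the degree by
`deg L = w_F`. For the lower index the same argument is applied to a second solution of the
Charlier recurrences, the iterated differences `a ^ (-x) Γ (x + 1) e_n (x)` of the function
`a ^ (-x) Γ (x + 1)`, which carry the negative indices `m = -n - 1`. The same `B` works
for them, and now the degree of the polynomial factor `e_n` grows as the index decreases.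
-/

/-! ### Charlier polynomials -/

theorem shiftPoly_eq_taylor (p : ℝ[X]) (s : ℝ) : shiftPoly p s = taylor s p := rfl

theorem taylor_binomPoly_succ (j : ℕ) :
    taylor 1 (binomPoly (j + 1)) = binomPoly (j + 1) + binomPoly j := by
  have h1 : (descPochhammer ℝ (j + 1)).comp (X + C 1) = (X + C 1) * descPochhammer ℝ j := by
    rw [descPochhammer_succ_left, mul_comp, X_comp, comp_assoc]
    simp
  have h2 : (((j + 1).factorial : ℝ)⁻¹) * (j + 1) = ((j.factorial : ℝ)⁻¹) := by
    rw [Nat.factorial_succ]; push_cast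
    have : (j.factorial : ℝ) ≠ 0 := by positivity
    field_simp
  rw [taylor_apply, binomPoly, binomPoly, mul_comp, C_comp, h1, descPochhammer_succ_right, ← h2,
    C_mul]
  simp only [C_add, C_1, map_natCast]
  ring

theorem natDegree_binomPoly_le (j : ℕ) : (binomPoly j).natDegree ≤ j :=
  (natDegree_C_mul_le _ _).trans (descPochhammer_natDegree ℝ j).le

theorem charlier_of_neg (a : ℝ) {n : ℤ} (h : n < 0) : charlier a n = 0 := by
  rw [charlier, if_pos h]

theorem charlier_natCast (a : ℝ) (n : ℕ) : charlier a n =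
    ∑ j ∈ Finset.range (n + 1), C ((-a) ^ (n - j) / ((n - j).factorial : ℝ)) * binomPoly j := by
  rw [charlier, if_neg (by omega), Int.toNat_natCast, Finset.mul_sum]
  refine Finset.sum_congr rfl fun j hj => ?_
  rw [Finset.mem_range] at hj
  have h := Nat.choose_mul_factorial_mul_factorial (show j ≤ n by omega)
  have h' : (n.choose j : ℝ) * j.factorial * (n - j).factorial = n.factorial := by exact_mod_cast h
  have h1 : (n.factorial : ℝ) ≠ 0 := by positivity
  have h2 : ((n - j).factorial : ℝ) ≠ 0 := by positivity
  have : (-a) ^ (n - j) / ((n - j).factorial : ℝ) =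
      (n.factorial : ℝ)⁻¹ * ((-a) ^ (n - j) * n.choose j) * j.factorial := by
    field_simp
    rw [← h']
    ring
  rw [this]
  simp only [C_mul]
  ring

theorem charlier_zero (a : ℝ) : charlier a 0 = 1 := by
  have := charlier_natCast a 0
  simpa [binomPoly] using this

theorem taylor_charlier (a : ℝ) (n : ℤ) :
    taylor 1 (charlier a n) = charlier a n + charlier a (n - 1) := by
  rcases lt_trichotomy n 0 with h | rfl | h
  · rw [charlier_of_neg a h, charlier_of_neg a (by omega)]
    simp
  · rw [charlier_of_neg a (show (0 : ℤ) - 1 < 0 by omega), charlier_zero]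
    simp
  · obtain ⟨m, rfl⟩ : ∃ m : ℕ, n = (m + 1 : ℕ) := ⟨(n - 1).toNat, by omega⟩
    rw [show ((m + 1 : ℕ) : ℤ) - 1 = (m : ℕ) by push_cast; ring, charlier_natCast,
      charlier_natCast, Finset.sum_range_succ' _ (m + 1)]
    simp only [Nat.add_sub_add_right, map_add, map_sum, ← smul_eq_C_mul, map_smul,
      taylor_binomPoly_succ, smul_add, Finset.sum_add_distrib]
    have : taylor 1 (binomPoly 0) = binomPoly 0 := by simp [binomPoly]
    rw [this]
    ring

theorem natDegree_charlier_le (a : ℝ) (n : ℕ) : (charlier a n).natDegree ≤ n := by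
  rw [charlier_natCast]
  refine natDegree_sum_le_of_forall_le _ _ fun j hj => ?_
  rw [Finset.mem_range] at hj
  exact (natDegree_C_mul_le _ _).trans ((natDegree_binomPoly_le j).trans (by omega))

theorem coeff_charlier_self (a : ℝ) (n : ℕ) :
    (charlier a n).coeff n = ((n.factorial : ℝ)⁻¹) := by
  rw [charlier_natCast, Finset.sum_range_succ, coeff_add, finsetSum_coeff, Finset.sum_eq_zero]
  · have h := monic_descPochhammer ℝ n
    rw [Monic, leadingCoeff, descPochhammer_natDegree] at h
    simp [binomPoly, h]
  · intro j hj
    rw [Finset.mem_range] at hj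
    exact coeff_eq_zero_of_natDegree_lt ((natDegree_C_mul_le _ _).trans_lt
      ((natDegree_binomPoly_le j).trans_lt hj))

theorem natDegree_charlier (a : ℝ) (n : ℕ) : (charlier a n).natDegree = n := by
  refine natDegree_eq_of_le_of_coeff_ne_zero (natDegree_charlier_le a n) ?_
  rw [coeff_charlier_self]
  positivity

theorem charlier_ne_zero (a : ℝ) (n : ℕ) : charlier a n ≠ 0 := fun h => by
  have := coeff_charlier_self a n
  rw [h, coeff_zero] at this
  exact absurd this.symm (by positivity)

theorem eval_zero_charlier (a : ℝ) (n : ℕ) :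
    (charlier a n).eval 0 = (-a) ^ n / n.factorial := by
  rw [charlier_natCast, eval_finsetSum, Finset.sum_eq_single 0]
  · simp [binomPoly]
  · intro j _ hj
    simp [binomPoly, descPochhammer_ne_zero_eval_zero ℝ hj]
  · simp

/-- A polynomial is determined by its difference and its value at `0`. -/
theorem eq_of_taylor_sub_eq {p q : ℝ[X]} (h : taylor 1 p - p = taylor 1 q - q)
    (h0 : p.eval 0 = q.eval 0) : p = q := by
  have key : ∀ n : ℕ, p.eval (n : ℝ) = q.eval (n : ℝ) := by
    intro n
    induction n with
    | zero => simpa using h0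
    | succ n ih =>
      have := congrArg (eval (n : ℝ)) h
      simp only [eval_sub, taylor_eval] at this
      push_cast
      linarith
  refine eq_of_infinite_eval_eq p q ((Set.infinite_range_of_injective
    (Nat.cast_injective (R := ℝ))).mono ?_)
  rintro _ ⟨n, rfl⟩
  exact key n

/-- The three term recurrence of the Charlier polynomials. Both sides have the same value at `0`
and, by induction on `n`, the same difference. -/
theorem X_mul_charlier (a : ℝ) (n : ℤ) : X * charlier a n =
    C (n + 1 : ℝ) * charlier a (n + 1) + C (n + a) * charlier a n + C a * charlier a (n - 1) := by
  rcases lt_or_ge n 0 with h | h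
  · rw [charlier_of_neg a h, charlier_of_neg a (show n - 1 < 0 by omega)]
    rcases eq_or_ne n (-1) with rfl | h'
    · simp
    · rw [charlier_of_neg a (show n + 1 < 0 by omega)]
      simp
  lift n to ℕ using h
  induction n with
  | zero =>
    refine eq_of_taylor_sub_eq ?_ ?_
    · simp only [taylor_mul, taylor_X, taylor_C, map_add, taylor_charlier]
      simp [charlier_zero, charlier_of_neg]
    · have := eval_zero_charlier a 1
      simp only [Nat.cast_one] at this
      simp [charlier_zero, charlier_of_neg, this]
  | succ n ih =>
    refine eq_of_taylor_sub_eq ?_ ?_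
    · simp only [taylor_mul, taylor_X, taylor_C, map_add, taylor_charlier]
      push_cast
      simp only [add_sub_cancel_right]
      push_cast at ih ⊢
      simp only [C_add, C_1] at ih ⊢
      linear_combination ih
    · have e1 : ((n + 1 : ℕ) : ℤ) - 1 = n := by push_cast; ring
      have e3 : ((n + 1 : ℕ) : ℤ) + 1 = (n + 2 : ℕ) := by push_cast; ring
      rw [e1, e3]
      simp only [eval_mul, eval_add, eval_X, eval_C, eval_zero_charlier]
      have h1 : (n.factorial : ℝ) ≠ 0 := by positivity
      simp only [Nat.factorial_succ]
      push_cast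
      field_simp
      ring

/-- Every polynomial is the forward difference of a polynomial. -/
theorem exists_taylor_sub_eq (p : ℝ[X]) : ∃ P : ℝ[X], taylor 1 P - P = p := by
  let S : Polynomial.Sequence ℝ :=
    { elems' := fun n => charlier 0 n
      degree_eq' := fun n => by
        rw [degree_eq_natDegree (charlier_ne_zero 0 n), natDegree_charlier] }
  have hp : p ∈ Submodule.span ℝ (Set.range S) := by
    rw [S.span fun i => (isUnit_iff_ne_zero.mpr
      (leadingCoeff_ne_zero.mpr (charlier_ne_zero 0 i)))]
    trivial
  have hle : Submodule.span ℝ (Set.range S) ≤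
      LinearMap.range (taylor (1 : ℝ) - LinearMap.id) := by
    rw [Submodule.span_le]
    rintro _ ⟨n, rfl⟩
    refine ⟨charlier 0 (n + 1), ?_⟩
    rw [LinearMap.sub_apply, taylor_charlier, LinearMap.id_apply, add_sub_cancel_right,
      add_sub_cancel_left]
  exact hle hp

/-! ### Degrees of determinants -/

theorem coeff_prod_of_natDegree_le_sum {ι : Type*} (s : Finset ι) (f : ι → ℝ[X]) (d : ι → ℕ)
    (h : ∀ i ∈ s, (f i).natDegree ≤ d i) :
    (∏ i ∈ s, f i).coeff (∑ i ∈ s, d i) = ∏ i ∈ s, (f i).coeff (d i) := by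
  classical
  induction s using Finset.induction_on with
  | empty => simp
  | insert i s hi ih =>
    rw [Finset.prod_insert hi, Finset.sum_insert hi, Finset.prod_insert hi,
      coeff_mul_add_eq_of_natDegree_le (h i (Finset.mem_insert_self _ _)) ?_,
      ih fun j hj => h j (Finset.mem_insert_of_mem hj)]
    exact (natDegree_prod_le _ _).trans
      (Finset.sum_le_sum fun j hj => h j (Finset.mem_insert_of_mem hj))

/-- If the entry `(i, j)` of a square matrix of polynomials has degree at most `d i - b j`, then
the determinant has degree `∑ d i - ∑ b j`, as soon as the determinant of the matrix of the
coefficients of degree `d i - b j` does not vanish. The weights `X ^ b j` on the columns avoid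
negative bounds: an entry with `d i < b j` has to be zero. -/
theorem natDegree_det_add_sum {n : Type*} [Fintype n] [DecidableEq n] (M : Matrix n n ℝ[X])
    (b d : n → ℕ) (h : ∀ i j, (X ^ b j * M i j).natDegree ≤ d i)
    (hdet : (Matrix.of fun i j => (X ^ b j * M i j).coeff (d i)).det ≠ 0) :
    M.det ≠ 0 ∧ M.det.natDegree + ∑ j, b j = ∑ i, d i := by
  have hle : (Matrix.of fun i j => X ^ b j * M i j).det.natDegree ≤ ∑ i, d i := by
    rw [← Matrix.det_transpose, Matrix.det_apply]
    refine natDegree_sum_le_of_forall_le _ _ fun τ _ => ?_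
    refine (natDegree_smul_le _ _).trans ((natDegree_prod_le _ _).trans ?_)
    exact Finset.sum_le_sum fun i _ => h i (τ i)
  have hco : (Matrix.of fun i j => X ^ b j * M i j).det.coeff (∑ i, d i) =
      (Matrix.of fun i j => (X ^ b j * M i j).coeff (d i)).det := by
    rw [← Matrix.det_transpose, Matrix.det_apply, ← Matrix.det_transpose (Matrix.of _),
      Matrix.det_apply, finsetSum_coeff]
    refine Finset.sum_congr rfl fun τ _ => ?_
    rw [Units.smul_def, Units.smul_def, coeff_smul]
    congr 1
    exact coeff_prod_of_natDegree_le_sum _ _ _ fun i _ => h i (τ i)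
  rw [← hco, Matrix.det_mul_row, Finset.prod_pow_eq_pow_sum] at hdet
  rw [Matrix.det_mul_row, Finset.prod_pow_eq_pow_sum] at hle
  have h0 : M.det ≠ 0 := by
    intro h0
    simp [h0] at hdet
  refine ⟨h0, ?_⟩
  have := natDegree_eq_of_le_of_coeff_ne_zero hle hdet
  rwa [natDegree_X_pow_mul _ h0] at this

/-- In a determinant whose columns are the iterates of operators `τ i` on the rows, the operators
can be replaced by `τ i - 1`, as this is a unipotent transformation of the columns. -/
theorem det_pow_apply_eq_det_sub_one_pow_apply {n : ℕ} (τ : Fin n → Module.End ℝ ℝ[X])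
    (v : Fin n → ℝ[X]) :
    (Matrix.of fun i j : Fin n => (τ i ^ (j : ℕ)) (v i)).det =
      (Matrix.of fun i j : Fin n => ((τ i - 1) ^ (j : ℕ)) (v i)).det := by
  let U : Matrix (Fin n) (Fin n) ℝ[X] := Matrix.of fun i j => (((j : ℕ).choose (i : ℕ) : ℕ) : ℝ[X])
  have hU : U.det = 1 := by
    rw [Matrix.det_of_isUpperTriangular]
    · simp [U]
    · intro i j hij
      have : (j : ℕ) < i := hij
      simp [U, Nat.choose_eq_zero_of_lt this]
  have hmul : (Matrix.of fun i j : Fin n => (τ i ^ (j : ℕ)) (v i)) =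
      (Matrix.of fun i j : Fin n => ((τ i - 1) ^ (j : ℕ)) (v i)) * U := by
    ext1 i j
    rw [Matrix.mul_apply]
    simp only [Matrix.of_apply, U]
    have h1 : τ i ^ (j : ℕ) = ((τ i - 1) + 1) ^ (j : ℕ) := by rw [sub_add_cancel]
    rw [h1, (Commute.one_right (τ i - 1)).add_pow, LinearMap.sum_apply,
      Fin.sum_univ_eq_sum_range
        (fun l => ((τ i - 1) ^ l) (v i) * (((j : ℕ).choose l : ℕ) : ℝ[X])) n]
    have hsub : Finset.range ((j : ℕ) + 1) ⊆ Finset.range n :=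
      Finset.range_subset_range.mpr j.2
    rw [← Finset.sum_subset hsub]
    · refine Finset.sum_congr rfl fun l _ => ?_
      rw [one_pow, mul_one, ← Nat.cast_comm, ← nsmul_eq_mul, LinearMap.smul_apply, nsmul_eq_mul,
        mul_comm]
    · intro l _ hl
      rw [Finset.mem_range, not_lt] at hl
      rw [Nat.choose_eq_zero_of_lt (by omega), Nat.cast_zero, mul_zero]
  rw [hmul, Matrix.det_mul, hU, mul_one]

theorem det_descFactorial_div_factorial_ne_zero {n : ℕ} {v : Fin n → ℕ}
    (hv : Function.Injective v) :
    (Matrix.of fun i j : Fin n =>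
      (((v i).descFactorial (j : ℕ) : ℝ) / ((v i).factorial : ℝ))).det ≠ 0 := by
  have h := Matrix.det_eval_matrixOfPolynomials_eq_det_vandermonde (fun i => (v i : ℝ))
    (fun j => descPochhammer ℝ j) (fun j => descPochhammer_natDegree ℝ j)
    (fun j => monic_descPochhammer ℝ j)
  simp only [descPochhammer_eval_eq_descFactorial] at h
  have h1 : (Matrix.of fun i j : Fin n =>
      (((v i).descFactorial (j : ℕ) : ℝ) / ((v i).factorial : ℝ))) =
      Matrix.of fun i j : Fin n => ((v i).factorial : ℝ)⁻¹ *
        (Matrix.of fun i j : Fin n => ((v i).descFactorial (j : ℕ) : ℝ)) i j := by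
    ext i j
    simp [div_eq_inv_mul]
  rw [h1, Matrix.det_mul_column, ← h]
  refine mul_ne_zero (Finset.prod_ne_zero_iff.mpr fun i _ => by positivity) ?_
  exact Matrix.det_vandermonde_ne_zero_iff.mpr (Nat.cast_injective.comp hv)

theorem taylor_sub_one_pow_charlier (a : ℝ) (n : ℤ) (j : ℕ) :
    ((taylor (1 : ℝ) - 1 : Module.End ℝ ℝ[X]) ^ j) (charlier a n) = charlier a (n - j) := by
  induction j with
  | zero => simp
  | succ j ih =>
    rw [pow_succ', Module.End.mul_apply, ih, LinearMap.sub_apply, taylor_charlier,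
      Module.End.one_apply, add_sub_cancel_left]
    push_cast
    ring_nf

theorem natDegree_X_pow_mul_charlier_le (a : ℝ) (n j : ℕ) :
    (X ^ j * charlier a (n - j)).natDegree ≤ n := by
  rcases le_or_gt j n with h | h
  · rw [← Nat.cast_sub h]
    refine natDegree_mul_le.trans ?_
    rw [natDegree_X_pow, natDegree_charlier]
    omega
  · rw [charlier_of_neg a (by omega)]
    simp

theorem coeff_X_pow_mul_charlier (a : ℝ) (n j : ℕ) :
    (X ^ j * charlier a (n - j)).coeff n = (n.descFactorial j : ℝ) / n.factorial := by
  rcases le_or_gt j n with h | h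
  · rw [← Nat.cast_sub h, coeff_X_pow_mul', if_pos h, coeff_charlier_self,
      ← Nat.factorial_mul_descFactorial h]
    have h1 : ((n - j).factorial : ℝ) ≠ 0 := by positivity
    have h2 : (n.descFactorial j : ℝ) ≠ 0 := by
      exact_mod_cast (Nat.descFactorial_pos.mpr h).ne'
    push_cast
    field_simp
  · rw [charlier_of_neg a (by omega), Nat.descFactorial_of_lt h]
    simp

/-- The degree of the Casoratian determinant of Charlier polynomials of different degrees. -/
theorem natDegree_det_charlier {n : ℕ} (a : ℝ) {v : Fin n → ℕ} (hv : Function.Injective v) :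
    (Matrix.of fun i j : Fin n => charlier a ((v i : ℤ) - (j : ℕ))).det ≠ 0 ∧
    (Matrix.of fun i j : Fin n => charlier a ((v i : ℤ) - (j : ℕ))).det.natDegree
      + ∑ j : Fin n, (j : ℕ) = ∑ i, v i := by
  refine natDegree_det_add_sum _ (fun j : Fin n => (j : ℕ)) v
    (fun i j => natDegree_X_pow_mul_charlier_le a (v i) j) ?_
  simp only [Matrix.of_apply, coeff_X_pow_mul_charlier]
  exact det_descFactorial_div_factorial_ne_zero hv

/-! ### The Casorati operator and its intertwining relation -/

theorem taylor_natCast_eq_pow (j : ℕ) (p : ℝ[X]) :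
    taylor (j : ℝ) p = ((taylor (1 : ℝ) : Module.End ℝ ℝ[X]) ^ j) p := by
  induction j with
  | zero => simp
  | succ j ih =>
    rw [pow_succ', Module.End.mul_apply, ← ih, taylor_taylor]
    push_cast
    ring_nf

/-- The matrix `(q i (x + j))` of the Casoratian of the polynomials `q i`. -/
noncomputable def casoratiMatrix {k : ℕ} (q : Fin k → ℝ[X]) : Matrix (Fin k) (Fin k) ℝ[X] :=
  Matrix.of fun i j => taylor ((j : ℕ) : ℝ) (q i)

/-- The operator sending `p` to the determinant with first row `p, σ p, …, σ ^ k p` and further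
rows `q i (x), q i (x + 1), …, q i (x + k)`. The operator `σ` plays the role of the shift
`x ↦ x + 1` on a space of functions which are represented by polynomials `p`. -/
noncomputable def casoratiOp {k : ℕ} (σ : Module.End ℝ ℝ[X]) (q : Fin k → ℝ[X]) (p : ℝ[X]) :
    ℝ[X] :=
  (Matrix.of (Fin.cons (fun j : Fin (k + 1) => (σ ^ (j : ℕ)) p)
    (fun (i : Fin k) (j : Fin (k + 1)) => taylor ((j : ℕ) : ℝ) (q i))) :
      Matrix (Fin (k + 1)) (Fin (k + 1)) ℝ[X]).det

/-- A linear combination of the other rows may be subtracted from the first one. -/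
theorem det_cons_smul_sub_sum {R : Type*} [CommRing R] {k : ℕ} (w : Fin k → Fin (k + 1) → R)
    (v : Fin (k + 1) → R) (c : R) (b : Fin k → R) :
    (Matrix.of (Fin.cons (c • v - ∑ i, b i • w i) w) : Matrix (Fin (k + 1)) (Fin (k + 1)) R).det =
      c * (Matrix.of (Fin.cons v w) : Matrix (Fin (k + 1)) (Fin (k + 1)) R).det := by
  let f : (Fin (k + 1) → R) →ₗ[R] R :=
    { toFun := fun v => (Matrix.detRowAlternating (R := R)).curryLeft v w
      map_add' := by simp
      map_smul' := by simp }
  have hf : ∀ v, f v = (Matrix.of (Fin.cons v w) : Matrix (Fin (k + 1)) (Fin (k + 1)) R).det :=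
    fun v => rfl
  have hw : ∀ i, f (w i) = 0 := fun i =>
    (Matrix.detRowAlternating (R := R)).map_eq_zero_of_eq (Fin.cons (w i) w)
      (i := 0) (j := i.succ) (by simp) (Fin.succ_ne_zero i).symm
  rw [← hf, ← hf, map_sub, map_smul, map_sum, smul_eq_mul]
  simp [hw]

theorem casoratiOp_sum {k : ℕ} (σ : Module.End ℝ ℝ[X]) (q : Fin k → ℝ[X]) {ι : Type*}
    (s : Finset ι) (c : ι → ℝ) (p : ι → ℝ[X]) :
    casoratiOp σ q (∑ i ∈ s, C (c i) * p i) = ∑ i ∈ s, C (c i) * casoratiOp σ q (p i) := by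
  simp only [casoratiOp, Matrix.det_succ_row_zero, ← smul_eq_C_mul, map_sum, map_smul,
    Matrix.of_apply, Fin.cons_zero, Finset.mul_sum, Finset.sum_mul]
  rw [Finset.sum_comm]
  refine Finset.sum_congr rfl fun i _ => ?_
  refine Finset.sum_congr rfl fun j _ => ?_
  simp only [mul_smul_comm, smul_mul_assoc]
  rfl

/-- Let `Ω` be the Casoratian of the `q i` and `L (x) - L (x - 1) = Ω (x)`. If the difference of
`h i` is the determinant obtained from `Ω` by putting `p` in place of `q i`, then the Casorati
operator maps `L * p - ∑ q i * σ (h i)` to `L` times the image of `p`. By Cramer's rule, the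
`j`-th shift of this function is `L * σ ^ j p - ∑ q i (x + j) * σ (h i)` for all `j ≤ k`, with
coefficients independent of `j`; hence the first row of the determinant is `L` times that of
`p`, up to a combination of the other rows. -/
theorem casoratiOp_sub_sum {k : ℕ} (σ : Module.End ℝ ℝ[X])
    (hσ : ∀ p r, σ (p * r) = taylor 1 p * σ r) (q : Fin k → ℝ[X]) (L : ℝ[X])
    (hL : L - taylor (-1) L = (casoratiMatrix q).det) (p : ℝ[X]) (h : Fin k → ℝ[X])
    (hh : ∀ i, σ (h i) - h i =
      ∑ j : Fin k, (casoratiMatrix q).adjugate j i * (σ ^ (j : ℕ)) p) :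
    casoratiOp σ q (L * p - ∑ i, q i * σ (h i)) = L * casoratiOp σ q p := by
  have hcramer : ∀ l : ℕ, l < k → ∑ i, taylor (l : ℝ) (q i) * (σ (h i) - h i) =
      (casoratiMatrix q).det * (σ ^ l) p := by
    intro l hl
    have hadj : ∀ j : Fin k, ∑ i, (casoratiMatrix q).adjugate j i * taylor (l : ℝ) (q i) =
        if j = ⟨l, hl⟩ then (casoratiMatrix q).det else 0 := by
      intro j
      have := congrFun (congrFun (Matrix.adjugate_mul (casoratiMatrix q)) j) ⟨l, hl⟩
      rw [Matrix.mul_apply] at this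
      simpa [casoratiMatrix, Matrix.one_apply] using this
    simp only [hh, Finset.mul_sum]
    rw [Finset.sum_comm]
    calc _ = ∑ j : Fin k, (∑ i, (casoratiMatrix q).adjugate j i * taylor (l : ℝ) (q i)) *
          (σ ^ (j : ℕ)) p := by
          refine Finset.sum_congr rfl fun j _ => ?_
          rw [Finset.sum_mul]
          exact Finset.sum_congr rfl fun i _ => by ring
      _ = _ := by simp [hadj]
  have hL1 : taylor 1 L - L = taylor 1 (casoratiMatrix q).det := by
    rw [← hL, map_sub, taylor_taylor]
    simp
  have hshift : ∀ j : ℕ, j ≤ k → (σ ^ j) (L * p - ∑ i, q i * σ (h i)) =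
      L * (σ ^ j) p - ∑ i, σ (h i) * taylor (j : ℝ) (q i) := by
    intro j
    induction j with
    | zero =>
      intro _
      simp [mul_comm]
    | succ j ih =>
      intro hj
      have hc := congrArg σ (hcramer j hj)
      rw [hσ, map_sum] at hc
      simp only [hσ, map_sub, mul_sub, Finset.sum_sub_distrib, taylor_taylor] at hc
      rw [pow_succ', Module.End.mul_apply, ih (by omega), map_sub, map_sum, hσ,
        Module.End.mul_apply]
      simp only [mul_comm (σ _), hσ, taylor_taylor]
      rw [← hL1] at hc
      push_cast
      simp only [add_comm (1 : ℝ)] at hc ⊢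
      linear_combination -hc
  rw [casoratiOp, casoratiOp, ← det_cons_smul_sub_sum _ _ L fun i => σ (h i)]
  congr 2
  congr 1
  ext1 j
  rw [hshift j (by omega)]
  simp [Finset.sum_apply]

/-! ### Families of solutions of the Charlier recurrences -/

/-- A family `u m`, `m ∈ ℤ`, of functions represented by polynomials, on which the shift `σ` and
the multiplication by `x` act as on the Charlier polynomials. Both formulas are demanded only for
the indices `m` in a member of the filter `l`. -/
structure IsCharlierFamily (a : ℝ) (l : Filter ℤ) (σ : Module.End ℝ ℝ[X]) (u : ℤ → ℝ[X]) :
    Prop where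
  tendsto_add (s : ℤ) : Filter.Tendsto (· + s) l l
  map_mul (p r : ℝ[X]) : σ (p * r) = taylor 1 p * σ r
  shift : ∀ᶠ m in l, σ (u m) = u m + u (m - 1)
  X_mul : ∀ᶠ m in l, X * u m =
    C (m + 1 : ℝ) * u (m + 1) + C (m + a) * u m + C a * u (m - 1)

theorem isCharlierFamily_charlier (a : ℝ) : IsCharlierFamily a ⊤ (taylor 1) (charlier a) where
  tendsto_add _ := Filter.tendsto_top
  map_mul p r := taylor_mul 1 p r
  shift := Filter.Eventually.of_forall fun m => taylor_charlier a m
  X_mul := Filter.Eventually.of_forall fun m => X_mul_charlier a m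

/-- The shift `x ↦ x + 1` on the functions `a ^ (-x) Γ (x + 1) p (x)`, in terms of the polynomial
factor `p`. -/
noncomputable def dualShift (a : ℝ) : Module.End ℝ ℝ[X] :=
  LinearMap.mulLeft ℝ (C a⁻¹ * (X + 1)) ∘ₗ taylor 1

theorem dualShift_apply (a : ℝ) (p : ℝ[X]) :
    dualShift a p = C a⁻¹ * (X + 1) * taylor 1 p := rfl

/-- The polynomial factors of the iterated differences of the function `a ^ (-x) Γ (x + 1)`. -/
noncomputable def dualCharlier (a : ℝ) : ℕ → ℝ[X]
  | 0 => 1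
  | n + 1 => dualShift a (dualCharlier a n) - dualCharlier a n

/-- The polynomials `dualCharlier a n` in the order in which they continue the Charlier
recurrences to negative indices: `dualCharlier a n` has the index `-n - 1`. The values at the
indices `m ≥ 0` are irrelevant. -/
noncomputable def dualFamily (a : ℝ) (m : ℤ) : ℝ[X] :=
  dualCharlier a (-m - 1).toNat

theorem dualShift_dualCharlier (a : ℝ) (n : ℕ) :
    dualShift a (dualCharlier a n) = dualCharlier a n + dualCharlier a (n + 1) := by
  rw [dualCharlier, add_sub_cancel]

theorem dualShift_mul (a : ℝ) (p r : ℝ[X]) :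
    dualShift a (p * r) = taylor 1 p * dualShift a r := by
  rw [dualShift_apply, dualShift_apply, taylor_mul]
  ring

theorem X_mul_dualCharlier {a : ℝ} (ha : a ≠ 0) (n : ℕ) : X * dualCharlier a n =
    -C (n : ℝ) * dualCharlier a (n - 1) + C (a - n - 1) * dualCharlier a n
      + C a * dualCharlier a (n + 1) := by
  have haC : C a * C a⁻¹ = 1 := by rw [← C_mul, mul_inv_cancel₀ ha, C_1]
  induction n with
  | zero =>
    simp only [dualCharlier, dualShift_apply, taylor_one, C_sub, C_1]
    simp only [Nat.cast_zero, C_0]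
    linear_combination (-X - 1) * haC
  | succ n ih =>
    -- subtract the recurrence for `n` from its shift
    have h := congrArg (dualShift a) ih
    rw [dualShift_mul, taylor_X, map_add, map_add, neg_mul, map_neg] at h
    simp only [dualShift_mul, taylor_C, dualShift_dualCharlier, C_1] at h
    rcases n with _ | n
    · simp only [Nat.cast_zero, C_0] at h ih
      simp only [Nat.cast_add, Nat.cast_one, Nat.cast_zero, C_sub, C_add, C_1, C_0,
        Nat.add_sub_cancel] at h ih ⊢
      linear_combination h - ih
    · simp only [Nat.add_sub_cancel, Nat.cast_add, Nat.cast_one, C_sub, C_add, C_1] at h ih ⊢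
      linear_combination h - ih

theorem isCharlierFamily_dualFamily {a : ℝ} (ha : a ≠ 0) :
    IsCharlierFamily a Filter.atBot (dualShift a) (dualFamily a) where
  tendsto_add s := Filter.tendsto_atBot_add_const_right _ s Filter.tendsto_id
  map_mul := dualShift_mul a
  shift := by
    filter_upwards [Filter.eventually_lt_atBot 0] with m hm
    rw [dualFamily, dualFamily, dualShift_dualCharlier]
    congr 2
    omega
  X_mul := by
    filter_upwards [Filter.eventually_lt_atBot 0] with m hm
    obtain ⟨n, rfl⟩ : ∃ n : ℕ, m = -(n : ℤ) - 1 := ⟨(-m - 1).toNat, by omega⟩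
    have h := X_mul_dualCharlier ha n
    have e1 : (-(-(n : ℤ) - 1) - 1).toNat = n := by omega
    have e2 : (-(-(n : ℤ) - 1 + 1) - 1).toNat = n - 1 := by omega
    have e3 : (-(-(n : ℤ) - 1 - 1) - 1).toNat = n + 1 := by omega
    rw [dualFamily, dualFamily, dualFamily, e1, e2, e3, h]
    push_cast
    simp only [C_add, C_sub, C_neg, C_1]
    ring

theorem natDegree_dualCharlier {a : ℝ} (ha : a ≠ 0) (n : ℕ) :
    dualCharlier a n ≠ 0 ∧ (dualCharlier a n).natDegree = n := by
  induction n with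
  | zero => simp [dualCharlier]
  | succ n ih =>
    have hd : (dualShift a (dualCharlier a n)).natDegree = n + 1 := by
      rw [dualShift_apply, mul_assoc, natDegree_C_mul (inv_ne_zero ha), natDegree_mul,
        natDegree_taylor, ih.2, ← C_1, natDegree_X_add_C, add_comm]
      · rw [← C_1]; exact X_add_C_ne_zero 1
      · rw [Ne, taylor_eq_zero]
        exact ih.1
    have : (dualCharlier a (n + 1)).natDegree = n + 1 := by
      rw [dualCharlier, natDegree_sub_eq_left_of_natDegree_lt, hd]
      rw [hd, ih.2]
      exact Nat.lt_succ_self n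
    refine ⟨?_, this⟩
    rintro h
    rw [h] at this
    simp at this

theorem dualShift_sub_one_pow_dualCharlier (a : ℝ) (n j : ℕ) :
    ((dualShift a - 1) ^ j) (dualCharlier a n) = dualCharlier a (n + j) := by
  induction j with
  | zero => simp
  | succ j ih =>
    rw [pow_succ', Module.End.mul_apply, ih]
    rfl

/-! ### Recurrence operators -/

/-- The recurrence operator with coefficients `B s`, which are polynomials in the index `m`,
applied to the family `u`: the value at `m` is `∑ B s (m) * u (m + s)`. -/
noncomputable def recSum (B : ℤ →₀ ℝ[X]) (u : ℤ → ℝ[X]) (m : ℤ) : ℝ[X] :=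
  B.sum fun s b => C (b.eval (m : ℝ)) * u (m + s)

/-- The families `φ i` arise from the families `u i` by one and the same recurrence operator. -/
def IsRecSum {ι : Type*} (l : ι → Filter ℤ) (u φ : ι → ℤ → ℝ[X]) : Prop :=
  ∃ B : ℤ →₀ ℝ[X], ∀ i, ∀ᶠ m in l i, φ i m = recSum B (u i) m

theorem recSum_add (B B' : ℤ →₀ ℝ[X]) (u : ℤ → ℝ[X]) (m : ℤ) :
    recSum (B + B') u m = recSum B u m + recSum B' u m := by
  rw [recSum, Finsupp.sum_add_index']
  · rfl
  · simp
  · intro s b b'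
    rw [eval_add, C_add, add_mul]

theorem recSum_single (s : ℤ) (b : ℝ[X]) (u : ℤ → ℝ[X]) (m : ℤ) :
    recSum (Finsupp.single s b) u m = C (b.eval (m : ℝ)) * u (m + s) := by
  rw [recSum, Finsupp.sum_single_index]
  simp

namespace IsRecSum

variable {ι : Type*} {l : ι → Filter ℤ} {u φ ψ : ι → ℤ → ℝ[X]}

theorem refl : IsRecSum l u u :=
  ⟨Finsupp.single 0 1, fun i => Filter.Eventually.of_forall fun m => by
    rw [recSum_single]; simp⟩

theorem congr (h : IsRecSum l u φ) (hψ : ∀ i, ∀ᶠ m in l i, ψ i m = φ i m) : IsRecSum l u ψ := by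
  obtain ⟨B, hB⟩ := h
  refine ⟨B, fun i => ?_⟩
  filter_upwards [hB i, hψ i] with m h1 h2
  rw [h2, h1]

theorem zero : IsRecSum l u fun _ _ => 0 :=
  ⟨0, fun i => Filter.Eventually.of_forall fun m => by simp [recSum]⟩

theorem add (h : IsRecSum l u φ) (h' : IsRecSum l u ψ) :
    IsRecSum l u fun i m => φ i m + ψ i m := by
  obtain ⟨B, hB⟩ := h
  obtain ⟨B', hB'⟩ := h'
  refine ⟨B + B', fun i => ?_⟩
  filter_upwards [hB i, hB' i] with m h1 h2
  rw [recSum_add, h1, h2]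

theorem sum {κ : Type*} (s : Finset κ) {φ : κ → ι → ℤ → ℝ[X]} (h : ∀ j, IsRecSum l u (φ j)) :
    IsRecSum l u fun i m => ∑ j ∈ s, φ j i m := by
  classical
  induction s using Finset.induction_on with
  | empty => simpa using zero
  | insert j s hj ih =>
    simp only [Finset.sum_insert hj]
    exact (h j).add ih

theorem shift_mul (hl : ∀ i s, Filter.Tendsto (· + s) (l i) (l i)) (h : IsRecSum l u φ)
    (s : ℤ) (b : ℝ[X]) : IsRecSum l u fun i m => C (b.eval (m : ℝ)) * φ i (m + s) := by
  have key : ∀ B : ℤ →₀ ℝ[X], IsRecSum l u fun i m =>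
      C (b.eval (m : ℝ)) * recSum B (u i) (m + s) := by
    intro B
    induction B using Finsupp.induction_linear with
    | zero => simpa [recSum] using zero
    | add B B' h h' => simpa only [recSum_add, mul_add] using h.add h'
    | single t c =>
      refine ⟨Finsupp.single (s + t) (b * taylor (s : ℝ) c), fun i =>
        Filter.Eventually.of_forall fun m => ?_⟩
      beta_reduce
      rw [recSum_single, recSum_single, eval_mul, taylor_eval, C_mul, mul_assoc, add_assoc]
      push_cast
      rfl
  obtain ⟨B, hB⟩ := h
  refine (key B).congr fun i => ?_
  filter_upwards [(hl i s).eventually (hB i)] with m hm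
  rw [hm]

/-- A linear operator which acts on the families `u i` by a recurrence operator preserves the
families that arise from the `u i` by recurrence operators. -/
theorem map (hl : ∀ i s, Filter.Tendsto (· + s) (l i) (l i)) (f : ι → Module.End ℝ ℝ[X])
    (hf : IsRecSum l u fun i m => f i (u i m)) (h : IsRecSum l u φ) :
    IsRecSum l u fun i m => f i (φ i m) := by
  have key : ∀ B : ℤ →₀ ℝ[X], IsRecSum l u fun i m => f i (recSum B (u i) m) := by
    intro B
    induction B using Finsupp.induction_linear with
    | zero => simpa [recSum] using zero
    | add B B' h h' => simpa only [recSum_add, map_add] using h.add h'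
    | single s b =>
      simp only [recSum_single, ← smul_eq_C_mul, map_smul]
      simpa only [smul_eq_C_mul] using hf.shift_mul hl s b
  obtain ⟨B, hB⟩ := h
  refine (key B).congr fun i => ?_
  filter_upwards [hB i] with m hm
  rw [hm]

variable {a : ℝ} {σ : ι → Module.End ℝ ℝ[X]}

theorem shift (H : ∀ i, IsCharlierFamily a (l i) (σ i) (u i)) (h : IsRecSum l u φ) :
    IsRecSum l u fun i m => σ i (φ i m) := by
  refine map (fun i => (H i).tendsto_add) σ ?_ h
  refine (refl.add (refl.shift_mul (fun i => (H i).tendsto_add) (-1) 1)).congr fun i => ?_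
  filter_upwards [(H i).shift] with m hm
  rw [hm, eval_one, C_1, one_mul, sub_eq_add_neg]

theorem shift_pow (H : ∀ i, IsCharlierFamily a (l i) (σ i) (u i)) (h : IsRecSum l u φ) (j : ℕ) :
    IsRecSum l u fun i m => (σ i ^ j) (φ i m) := by
  induction j with
  | zero => simpa using h
  | succ j ih =>
    simp only [pow_succ', Module.End.mul_apply]
    exact ih.shift H

theorem mul (H : ∀ i, IsCharlierFamily a (l i) (σ i) (u i)) (h : IsRecSum l u φ) (p : ℝ[X]) :
    IsRecSum l u fun i m => p * φ i m := by
  have hl := fun i => (H i).tendsto_add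
  have hX : ∀ {φ}, IsRecSum l u φ → IsRecSum l u fun i m => X * φ i m := by
    intro φ h
    refine map hl (fun _ => LinearMap.mulLeft ℝ X) ?_ h
    refine (((refl.shift_mul hl 1 (X + 1)).add (refl.shift_mul hl 0 (X + C a))).add
      (refl.shift_mul hl (-1) (C a))).congr fun i => ?_
    filter_upwards [(H i).X_mul] with m hm
    simpa [sub_eq_add_neg] using hm
  have hC : ∀ {φ} (c : ℝ), IsRecSum l u φ → IsRecSum l u fun i m => C c * φ i m := by
    intro φ c h
    simpa using h.shift_mul hl 0 (C c)
  induction p using Polynomial.induction_on with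
  | C c => exact hC c h
  | add p q hp hq => simpa only [add_mul] using hp.add hq
  | monomial n c ih =>
    refine (hX ih).congr fun i => Filter.Eventually.of_forall fun m => ?_
    ring

/-- As `u m` is the difference of `u (m + 1)`, differences can be inverted by a recurrence
operator. -/
theorem exists_shift_sub_eq (H : ∀ i, IsCharlierFamily a (l i) (σ i) (u i))
    (h : IsRecSum l u φ) : ∃ ψ, IsRecSum l u ψ ∧
      ∀ i, ∀ᶠ m in l i, σ i (ψ i m) - ψ i m = φ i m := by
  have hl := fun i => (H i).tendsto_add
  have key : ∀ B : ℤ →₀ ℝ[X], ∃ ψ, IsRecSum l u ψ ∧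
      ∀ i, ∀ᶠ m in l i, σ i (ψ i m) - ψ i m = recSum B (u i) m := by
    intro B
    induction B using Finsupp.induction_linear with
    | zero => exact ⟨_, zero, by simp [recSum]⟩
    | add B B' h h' =>
      obtain ⟨ψ, h1, h2⟩ := h
      obtain ⟨ψ', h1', h2'⟩ := h'
      refine ⟨_, h1.add h1', fun i => ?_⟩
      filter_upwards [h2 i, h2' i] with m e e'
      rw [recSum_add, map_add, ← e, ← e']
      ring
    | single s b =>
      refine ⟨_, refl.shift_mul hl (s + 1) b, fun i => ?_⟩
      filter_upwards [(hl i (s + 1)).eventually (H i).shift] with m hm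
      rw [recSum_single, ← smul_eq_C_mul, ← smul_eq_C_mul, map_smul, hm, smul_add,
        add_sub_cancel_left]
      congr 2
      ring
  obtain ⟨B, hB⟩ := h
  obtain ⟨ψ, h1, h2⟩ := key B
  refine ⟨ψ, h1, fun i => ?_⟩
  filter_upwards [hB i, h2 i] with m e e'
  rw [e', e]

end IsRecSum

/-- There is one recurrence operator which, on all given families at once, corresponds to the
multiplication by `L` after the Casorati operator has been applied. -/
theorem exists_casoratiOp_recSum_eq {ι : Type*} {a : ℝ} {l : ι → Filter ℤ}
    {σ : ι → Module.End ℝ ℝ[X]} {u : ι → ℤ → ℝ[X]}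
    (H : ∀ i, IsCharlierFamily a (l i) (σ i) (u i)) {k : ℕ} (q : Fin k → ℝ[X]) (L : ℝ[X])
    (hL : L - taylor (-1) L = (casoratiMatrix q).det) :
    ∃ B : ℤ →₀ ℝ[X], ∀ i, ∀ᶠ m in l i,
      casoratiOp (σ i) q (recSum B (u i) m) = L * casoratiOp (σ i) q (u i m) := by
  have h1 : ∀ t : Fin k, IsRecSum l u fun i m =>
      ∑ j : Fin k, (casoratiMatrix q).adjugate j t * (σ i ^ (j : ℕ)) (u i m) := fun t =>
    IsRecSum.sum _ fun j => (IsRecSum.refl.shift_pow H j).mul H _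
  choose h hh hΔ using fun t => (h1 t).exists_shift_sub_eq H
  obtain ⟨B, hB⟩ := (IsRecSum.refl.mul H L).add
    (IsRecSum.sum Finset.univ fun t => ((hh t).shift H).mul H (-q t))
  refine ⟨B, fun i => ?_⟩
  filter_upwards [hB i, Filter.eventually_all.mpr fun t => hΔ t i] with m e eΔ
  rw [← e, ← casoratiOp_sub_sum (σ i) (H i).map_mul q L hL (u i m) (fun t => h t i m) eΔ]
  simp only [neg_mul, Finset.sum_neg_distrib, sub_eq_add_neg]

/-! ### The band width of the recurrence -/

theorem eventually_eval_ne_zero {α : Type*} {g : α → ℝ} (hg : Function.Injective g) {p : ℝ[X]}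
    (hp : p ≠ 0) : ∀ᶠ x in Filter.cofinite, p.eval (g x) ≠ 0 := by
  refine hg.tendsto_cofinite.eventually (p := fun y => p.eval y ≠ 0) ?_
  have : {y | p.eval y = 0}.Finite := by
    simpa [IsRoot] using p.finite_setOfPred_isRoot hp
  exact this.compl_mem_cofinite

/-- A linear combination of polynomials has the degree of its unique term of highest degree. -/
theorem natDegree_sum_C_mul {ι : Type*} {S : Finset ι} {c : ι → ℝ} {p : ι → ℝ[X]} {i : ι}
    (hi : i ∈ S) (hc : c i ≠ 0) (hp : p i ≠ 0)
    (hlt : ∀ j ∈ S, j ≠ i → (p j).natDegree < (p i).natDegree) :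
    (∑ j ∈ S, C (c j) * p j).natDegree = (p i).natDegree := by
  refine natDegree_eq_of_le_of_coeff_ne_zero ?_ ?_
  · refine natDegree_sum_le_of_forall_le _ _ fun j hj => (natDegree_C_mul_le _ _).trans ?_
    rcases eq_or_ne j i with rfl | h
    · exact le_rfl
    · exact (hlt j hj h).le
  · rw [finsetSum_coeff, Finset.sum_eq_single i]
    · rw [coeff_C_mul]
      exact mul_ne_zero hc (leadingCoeff_ne_zero.mpr hp)
    · intro j hj h
      exact coeff_eq_zero_of_natDegree_lt ((natDegree_C_mul_le _ _).trans_lt (hlt j hj h))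
    · exact fun h => absurd hi h

theorem natDegree_sub_taylor {p : ℝ[X]} (h : p - taylor (-1) p ≠ 0) :
    p.natDegree = (p - taylor (-1) p).natDegree + 1 := by
  obtain ⟨N, hN⟩ : ∃ N, p.natDegree = N + 1 := by
    refine Nat.exists_eq_succ_of_ne_zero fun h0 => h ?_
    rw [eq_C_of_natDegree_eq_zero h0]
    simp
  have hcoeff : ∀ n, (p - taylor (-1) p).coeff n =
      (hasseDeriv n p).eval 0 - (hasseDeriv n p).eval (-1) := by
    intro n
    rw [coeff_sub, taylor_coeff, ← taylor_coeff 0, taylor_zero]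
  rw [hN]
  congr 1
  symm
  refine natDegree_eq_of_le_of_coeff_ne_zero ?_ ?_
  · rw [natDegree_le_iff_coeff_eq_zero]
    intro n hn
    have h0 : (hasseDeriv n p).natDegree = 0 := by
      have := natDegree_hasseDeriv_le p n
      omega
    rw [hcoeff, eq_C_of_natDegree_eq_zero h0]
    simp
  · have h1 : (hasseDeriv N p).natDegree ≤ 1 := by
      have := natDegree_hasseDeriv_le p N
      omega
    have h2 : p.coeff (N + 1) ≠ 0 := by
      rw [← hN]
      refine leadingCoeff_ne_zero.mpr ?_
      rintro rfl
      simp at h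
    rw [hcoeff, eq_X_add_C_of_natDegree_le_one h1, hasseDeriv_coeff, add_comm 1 N]
    have h3 : ((N + 1).choose N : ℝ) ≠ 0 := by
      rw [Nat.choose_succ_self_right]
      positivity
    simpa using ⟨Nat.cast_add_one_ne_zero N, h2⟩

/-- The values of the Casorati operator of Charlier polynomials, in terms of differences instead
of shifts. -/
theorem casoratiOp_charlier {k : ℕ} (a : ℝ) (f : Fin k → ℕ) (σ : Module.End ℝ ℝ[X]) (p : ℝ[X]) :
    casoratiOp σ (fun i => charlier a (f i)) p =
      (Matrix.of (Fin.cons (fun j : Fin (k + 1) => ((σ - 1) ^ (j : ℕ)) p)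
        (fun (i : Fin k) (j : Fin (k + 1)) => charlier a ((f i : ℤ) - (j : ℕ)))) :
      Matrix (Fin (k + 1)) (Fin (k + 1)) ℝ[X]).det := by
  have h := det_pow_apply_eq_det_sub_one_pow_apply
    (Fin.cons σ fun _ => taylor 1 : Fin (k + 1) → Module.End ℝ ℝ[X])
    (Fin.cons p fun i => charlier a (f i) : Fin (k + 1) → ℝ[X])
  refine Eq.trans ?_ (h.trans ?_)
  · rw [casoratiOp]
    congr 1
    ext1 i j
    refine Fin.cases ?_ (fun i => ?_) i
    · simp
    · simp [taylor_natCast_eq_pow]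
  · congr 1
    ext1 i j
    refine Fin.cases ?_ (fun i => ?_) i
    · simp
    · simp only [Matrix.of_apply, Fin.cons_succ]
      exact taylor_sub_one_pow_charlier a (f i) j

theorem natDegree_det_casoratiMatrix {k : ℕ} (a : ℝ) {f : Fin k → ℕ}
    (hf : Function.Injective f) :
    (casoratiMatrix fun i => charlier a (f i)).det ≠ 0 ∧
    (casoratiMatrix fun i => charlier a (f i)).det.natDegree + ∑ j : Fin k, (j : ℕ) =
      ∑ i, f i := by
  have h : (casoratiMatrix fun i => charlier a (f i)).det =
      (Matrix.of fun i j : Fin k => charlier a ((f i : ℤ) - (j : ℕ))).det := by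
    simp only [casoratiMatrix, taylor_natCast_eq_pow]
    rw [det_pow_apply_eq_det_sub_one_pow_apply (fun _ => taylor 1)]
    congr 1
    ext1 i j
    exact taylor_sub_one_pow_charlier a (f i) j
  rw [h]
  exact natDegree_det_charlier a hf

theorem natDegree_casoratiOp_charlier {k : ℕ} (a : ℝ) {f : Fin k → ℕ}
    (hf : Function.Injective f) {m : ℕ} (hm : ∀ i, f i ≠ m) :
    casoratiOp (taylor 1) (fun i => charlier a (f i)) (charlier a m) ≠ 0 ∧
    (casoratiOp (taylor 1) (fun i => charlier a (f i)) (charlier a m)).natDegree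
      + ∑ j : Fin (k + 1), (j : ℕ) = m + ∑ i, f i := by
  have hinj : Function.Injective (Fin.cons m f : Fin (k + 1) → ℕ) :=
    Fin.cons_injective_iff.mpr ⟨fun ⟨i, hi⟩ => hm i hi, hf⟩
  have h := natDegree_det_charlier a hinj
  rw [Fin.sum_cons] at h
  convert h using 4
  all_goals
    rw [casoratiOp_charlier]
    congr 1
    ext1 i j
    refine Fin.cases ?_ (fun i => ?_) i
    · simp only [Matrix.of_apply, Fin.cons_zero]
      exact taylor_sub_one_pow_charlier a m j
    · simp

theorem natDegree_casoratiOp_dualCharlier {k : ℕ} {a : ℝ} (ha : a ≠ 0) {f : Fin k → ℕ}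
    (hf : Function.Injective f) (n : ℕ) :
    casoratiOp (dualShift a) (fun i => charlier a (f i)) (dualCharlier a n) ≠ 0 ∧
    (casoratiOp (dualShift a) (fun i => charlier a (f i)) (dualCharlier a n)).natDegree
      + ∑ j : Fin (k + 1), (j : ℕ) = n + 2 * k + ∑ i, f i := by
  rw [casoratiOp_charlier]
  have h := natDegree_det_add_sum
    (Matrix.of (Fin.cons (fun j : Fin (k + 1) =>
        ((dualShift a - 1) ^ (j : ℕ)) (dualCharlier a n))
      (fun (i : Fin k) (j : Fin (k + 1)) => charlier a ((f i : ℤ) - (j : ℕ)))))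
    (fun j => (j : ℕ)) (Fin.cons (n + 2 * k) f) ?_ ?_
  · rwa [Fin.sum_cons] at h
  · intro i j
    refine Fin.cases ?_ (fun i => ?_) i
    · simp only [Matrix.of_apply, Fin.cons_zero, dualShift_sub_one_pow_dualCharlier]
      refine natDegree_mul_le.trans ?_
      rw [natDegree_X_pow, (natDegree_dualCharlier ha _).2]
      omega
    · simp only [Matrix.of_apply, Fin.cons_succ]
      exact natDegree_X_pow_mul_charlier_le a (f i) j
  · -- the first row of coefficients vanishes except for its last entry
    rw [Matrix.det_succ_row_zero, Finset.sum_eq_single (Fin.last k)]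
    · refine mul_ne_zero (mul_ne_zero (pow_ne_zero _ (by norm_num)) ?_) ?_
      · simp only [Matrix.of_apply, Fin.cons_zero, dualShift_sub_one_pow_dualCharlier,
          Fin.val_last]
        rw [show n + 2 * k = (n + k) + k by ring, coeff_X_pow_mul]
        have := natDegree_dualCharlier ha (n + k)
        conv_lhs => arg 2; rw [← this.2]
        exact leadingCoeff_ne_zero.mpr this.1
      · convert det_descFactorial_div_factorial_ne_zero hf using 3
        ext i j
        simp [coeff_X_pow_mul_charlier]
    · intro j _ hj
      have hj' : (j : ℕ) < k := Fin.val_lt_last hj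
      simp only [Matrix.of_apply, Fin.cons_zero, dualShift_sub_one_pow_dualCharlier]
      rw [coeff_eq_zero_of_natDegree_lt, mul_zero, zero_mul]
      refine natDegree_mul_le.trans_lt ?_
      rw [natDegree_X_pow, (natDegree_dualCharlier ha _).2]
      omega
    · simp

theorem casoratiOp_recSum {k : ℕ} (σ : Module.End ℝ ℝ[X]) (q : Fin k → ℝ[X]) (B : ℤ →₀ ℝ[X])
    (u : ℤ → ℝ[X]) (m : ℤ) : casoratiOp σ q (recSum B u m) =
      ∑ s ∈ B.support, C ((B s).eval (m : ℝ)) * casoratiOp σ q (u (m + s)) :=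
  casoratiOp_sum σ q _ _ _

section Band

variable {k : ℕ} {a : ℝ} {f : Fin k → ℕ} {B : ℤ →₀ ℝ[X]} {L : ℝ[X]}

/-- For `m → ∞` the degrees in the relation defining `B` show the highest index that occurs. -/
theorem eq_natDegree_of_isGreatest (hf : Function.Injective f) (hL : L ≠ 0)
    (hB : ∀ m, casoratiOp (taylor 1) (fun i => charlier a (f i)) (recSum B (charlier a) m) =
      L * casoratiOp (taylor 1) (fun i => charlier a (f i)) (charlier a m))
    {s : ℤ} (hs : s ∈ B.support) (hmax : ∀ t ∈ B.support, t ≤ s) : s = L.natDegree := by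
  have hdeg : ∀ n : ℤ, 0 ≤ n → (∀ i, (f i : ℤ) < n) →
      casoratiOp (taylor 1) (fun i => charlier a (f i)) (charlier a n) ≠ 0 ∧
      ((casoratiOp (taylor 1) (fun i => charlier a (f i)) (charlier a n)).natDegree : ℤ)
        + ∑ j : Fin (k + 1), (j : ℕ) = n + ∑ i, f i := by
    intro n h0 hn
    lift n to ℕ using h0
    obtain ⟨h1, h2⟩ := natDegree_casoratiOp_charlier a hf (m := n)
      fun i => by have := hn i; omega
    exact ⟨h1, by exact_mod_cast h2⟩
  have hlarge : ∀ t : ℤ, ∀ᶠ m : ℤ in Filter.atTop, 0 ≤ m + t ∧ ∀ i, (f i : ℤ) < m + t := by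
    intro t
    have ht := Filter.tendsto_atTop_add_const_right (Filter.atTop : Filter ℤ) t Filter.tendsto_id
    exact (ht.eventually (Filter.eventually_ge_atTop 0)).and
      (Filter.eventually_all.mpr fun i => ht.eventually (Filter.eventually_gt_atTop (f i : ℤ)))
  obtain ⟨m, h0, h1, h2⟩ := ((hlarge 0).and (((Finset.eventually_all B.support).mpr
    fun t _ => hlarge t).and (Filter.atTop_le_cofinite (eventually_eval_ne_zero
      (Int.cast_injective (α := ℝ)) (Finsupp.mem_support_iff.mp hs))))).exists
  rw [add_zero] at h0
  obtain ⟨d1, d2⟩ := hdeg m h0.1 h0.2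
  obtain ⟨e1, e2⟩ := hdeg (m + s) (h1 s hs).1 (h1 s hs).2
  have h := congrArg natDegree (hB m)
  rw [casoratiOp_recSum, natDegree_mul hL d1, natDegree_sum_C_mul hs h2 e1] at h
  · omega
  · intro t ht hts
    have := (hdeg (m + t) (h1 t ht).1 (h1 t ht).2).2
    have := lt_of_le_of_ne (hmax t ht) hts
    omega

/-- For `m → -∞` the degrees in the relation defining `B` on the dual family show the lowest
index that occurs. -/
theorem eq_neg_natDegree_of_isLeast (ha : a ≠ 0) (hf : Function.Injective f) (hL : L ≠ 0)
    (hB : ∀ᶠ m in Filter.atBot,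
      casoratiOp (dualShift a) (fun i => charlier a (f i)) (recSum B (dualFamily a) m) =
      L * casoratiOp (dualShift a) (fun i => charlier a (f i)) (dualFamily a m))
    {s : ℤ} (hs : s ∈ B.support) (hmin : ∀ t ∈ B.support, s ≤ t) : s = -(L.natDegree : ℤ) := by
  have hdeg : ∀ n : ℤ, n < 0 →
      casoratiOp (dualShift a) (fun i => charlier a (f i)) (dualFamily a n) ≠ 0 ∧
      ((casoratiOp (dualShift a) (fun i => charlier a (f i)) (dualFamily a n)).natDegree : ℤ)
        + ∑ j : Fin (k + 1), (j : ℕ) = -n - 1 + 2 * k + ∑ i, f i := by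
    intro n hn
    obtain ⟨N, rfl⟩ : ∃ N : ℕ, n = -(N : ℤ) - 1 := ⟨(-n - 1).toNat, by omega⟩
    obtain ⟨h1, h2⟩ := natDegree_casoratiOp_dualCharlier ha hf N
    rw [dualFamily, show (-(-(N : ℤ) - 1) - 1).toNat = N by omega]
    exact ⟨h1, by omega⟩
  have hsmall : ∀ t : ℤ, ∀ᶠ m : ℤ in Filter.atBot, m + t < 0 := fun t =>
    (Filter.tendsto_atBot_add_const_right (Filter.atBot : Filter ℤ) t
      Filter.tendsto_id).eventually (Filter.eventually_lt_atBot 0)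
  obtain ⟨m, h, h0, h1, h2⟩ := (hB.and ((hsmall 0).and (((Finset.eventually_all B.support).mpr
    fun t _ => hsmall t).and (Filter.atBot_le_cofinite (eventually_eval_ne_zero
      (Int.cast_injective (α := ℝ)) (Finsupp.mem_support_iff.mp hs)))))).exists
  rw [add_zero] at h0
  obtain ⟨d1, d2⟩ := hdeg m h0
  obtain ⟨e1, e2⟩ := hdeg (m + s) (h1 s hs)
  have h := congrArg natDegree h
  rw [casoratiOp_recSum, natDegree_mul hL d1, natDegree_sum_C_mul hs h2 e1] at h
  · omega
  · intro t ht hts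
    have := (hdeg (m + t) (h1 t ht)).2
    have := lt_of_le_of_ne (hmin t ht) hts.symm
    omega

end Band

/-! ### Exceptional Charlier polynomials -/

theorem nthElem_injective (F : Finset ℕ) : Function.Injective (nthElem F) :=
  (F.orderEmbOfFin rfl).injective

theorem sum_nthElem (F : Finset ℕ) : ∑ i, nthElem F i = ∑ f ∈ F, f := by
  conv_rhs => rw [← F.map_orderEmbOfFin_univ rfl, Finset.sum_map]
  rfl

theorem casoratian_eq (a : ℝ) (F : Finset ℕ) :
    casoratian a F = (casoratiMatrix fun i => charlier a (nthElem F i)).det := rfl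

theorem exceptionalCharlier_eq (a : ℝ) (F : Finset ℕ) (n : ℤ) : exceptionalCharlier a F n =
    casoratiOp (taylor 1) (fun i => charlier a (nthElem F i)) (charlier a (n - uF F)) := by
  rw [exceptionalCharlier, exceptionalCharlierMatrix, casoratiOp]
  simp only [← taylor_natCast_eq_pow]
  rfl

theorem natDegree_of_isLambda {a : ℝ} {F : Finset ℕ} {L : ℝ[X]} (hL : IsLambda a F L) :
    (L.natDegree : ℤ) = wF F := by
  obtain ⟨h0, h⟩ := natDegree_det_casoratiMatrix a (nthElem_injective F)
  rw [← casoratian_eq, ← hL] at h0 h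
  have h1 := natDegree_sub_taylor h0
  rw [sum_nthElem, Fin.sum_univ_eq_sum_range (fun j => j), Finset.sum_range_id,
    ← Nat.choose_two_right] at h
  rw [shiftPoly_eq_taylor] at h
  rw [wF, ← Nat.cast_sum]
  omega

theorem corollary1 (a : ℝ) (ha : a ≠ 0) (F : Finset ℕ) (hF : ∀ f ∈ F, 0 < f) :
    (∃ L : ℝ[X], IsLambda a F L) ∧
    ∀ L : ℝ[X], IsLambda a F L →
      (L.natDegree : ℤ) = wF F ∧
      ∃ A : ℤ → RatFunc ℝ,
        (∀ j ∈ Finset.Icc (-wF F) (wF F), ∀ n : ℕ, (A j).denom.eval (n : ℝ) ≠ 0) ∧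
        (∀ n : ℕ,
          ∑ j ∈ Finset.Icc (-wF F) (wF F),
              C (ratVal (A j) n) * exceptionalCharlier a F ((n : ℤ) + j) =
            L * exceptionalCharlier a F (n : ℤ)) ∧
        (∀ᶠ n : ℕ in Filter.atTop, ratVal (A (wF F)) n ≠ 0) := by
  constructor
  · obtain ⟨P, hP⟩ := exists_taylor_sub_eq (casoratian a F)
    refine ⟨taylor 1 P, ?_⟩
    rw [IsLambda, shiftPoly_eq_taylor, taylor_taylor, neg_add_cancel, taylor_zero, hP]
  intro L hL
  have hw := natDegree_of_isLambda hL
  refine ⟨hw, ?_⟩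
  have hf := nthElem_injective F
  have hL0 : L ≠ 0 := by
    rintro rfl
    refine (natDegree_det_casoratiMatrix a hf).1 ?_
    rw [← casoratian_eq, ← hL, shiftPoly_eq_taylor, map_zero, sub_zero]
  -- the Charlier polynomials and their dual family
  have H : ∀ b : Bool, IsCharlierFamily a (cond b ⊤ Filter.atBot)
      (cond b (taylor 1) (dualShift a)) (cond b (charlier a) (dualFamily a)) := fun b =>
    match b with
    | true => isCharlierFamily_charlier a
    | false => isCharlierFamily_dualFamily ha
  obtain ⟨B, hB⟩ := exists_casoratiOp_recSum_eq H (fun i => charlier a (nthElem F i)) L hL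
  have hB1 := Filter.eventually_top.mp (hB true)
  have hB2 := hB false
  simp only [cond_true, cond_false] at hB1 hB2
  have hne : B.support.Nonempty := by
    rw [Finset.nonempty_iff_ne_empty, Ne, Finsupp.support_eq_empty]
    rintro rfl
    obtain ⟨m, hm⟩ := Infinite.exists_notMem_finset F
    have h1 := (natDegree_casoratiOp_charlier a hf (m := m) fun i h =>
      hm (h ▸ F.orderEmbOfFin_mem rfl i)).1
    have h2 := hB1 m
    rw [casoratiOp_recSum, Finsupp.support_zero, Finset.sum_empty] at h2
    exact mul_ne_zero hL0 h1 h2.symm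
  have hmax := eq_natDegree_of_isGreatest hf hL0 hB1 (B.support.max'_mem hne)
    fun t ht => B.support.le_max' t ht
  have hmin := eq_neg_natDegree_of_isLeast ha hf hL0 hB2 (B.support.min'_mem hne)
    fun t ht => B.support.min'_le t ht
  rw [hw] at hmax hmin
  have hsub : B.support ⊆ Finset.Icc (-wF F) (wF F) := fun t ht => by
    rw [Finset.mem_Icc, ← hmin, ← hmax]
    exact ⟨B.support.min'_le t ht, B.support.le_max' t ht⟩
  have hval : ∀ (j : ℤ) (n : ℕ), ratVal (algebraMap ℝ[X] (RatFunc ℝ)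
      (taylor (-(uF F : ℝ)) (B j))) n = (B j).eval (((n : ℤ) - uF F : ℤ) : ℝ) := by
    intro j n
    rw [ratVal, RatFunc.eval_algebraMap]
    simp [taylor_eval, sub_eq_add_neg]
  refine ⟨fun j => algebraMap ℝ[X] (RatFunc ℝ) (taylor (-(uF F : ℝ)) (B j)), ?_, ?_, ?_⟩
  · intro j _ n
    rw [RatFunc.denom_algebraMap, eval_one]
    exact one_ne_zero
  · intro n
    simp only [hval, exceptionalCharlier_eq]
    rw [← hB1, casoratiOp_recSum]
    symm
    refine (Finset.sum_subset hsub fun t _ ht => ?_).trans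
      (Finset.sum_congr rfl fun t _ => ?_)
    · rw [Finsupp.notMem_support_iff.mp ht, eval_zero, C_0, zero_mul]
    · rw [sub_add_eq_add_sub]
  · have hBw : B (wF F) ≠ 0 := by
      rw [← Finsupp.mem_support_iff, ← hmax]
      exact B.support.max'_mem hne
    have hinj : Function.Injective fun n : ℕ => (((n : ℤ) - uF F : ℤ) : ℝ) := fun m n h => by
      simpa using h
    simp only [hval]
    exact Filter.atTop_le_cofinite (eventually_eval_ne_zero hinj hBw)
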